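/- An anchored substring oracle (AS-oracle) of size $N$ is a hidden string $X=x_0x_1\cdots x_{N-1}\in\{0,1\}^N$. A query is a pair $q=(i,s)$ with $i\in\{0,\dots,N-1\}$ and $s\in\{0,1\}^*$, and its answer is $\tau(X;q)=1$ if $i+|s|\le N$ and $x_ix_{i+1}\cdots x_{i+|s|-1}=s$, and $\tau(X;q)=0$ otherwise. A quantum algorithm starts from a fixed state, alternates input-independent unitaries with the oracle unitary $O_X|q,a,z\rangle=|q,a\oplus\tau(X;q),z\rangle$ (where $z$ is the content of a work register), and finally measures in the computational basis to produce its output. Its number of queries is the number of uses of $O_X$. It identifies the AS-oracle with error $\varepsilon$ if for every $X\in\{0,1\}^N$ it outputs $X$ with probability at least $1-\varepsilon$. **Lemma.** For every constant $\varepsilon$ with $0\le\varepsilon<\tfrac12$, the $\varepsilon$-error quantum query complexity of identifying an AS-oracle, that is, the least number of queries of a quantum algorithm that identifies the AS-oracle of size $N$ with error $\varepsilon$, is $\Omega\!\left(\frac{N}{\log N}\right)$: there are $c>0$ and $N_0$, depending only on $\varepsilon$, such that it is at least $c\,N/\log N$ for all $N\ge N_0$. -/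

import Mathlib

open scoped ENNReal

/-- The Hilbert space `ℓ²(ι, ℂ)` with orthonormal basis `|b⟩`, `b : ι`. -/
abbrev StateSpace (ι : Type) : Type := lp (fun _ : ι => ℂ) 2

theorem memlp_comp_equiv {ι : Type} (σ : Equiv.Perm ι) (ψ : StateSpace ι) :
    Memℓp (fun b => ψ (σ b)) (2 : ℝ≥0∞) := by
  have h2 : 0 < (2 : ℝ≥0∞).toReal := by norm_num
  have h := (memℓp_gen_iff h2).1 (lp.memℓp ψ)
  exact memℓp_gen ((Equiv.summable_iff σ).2 h)

/-- The unitary that permutes the basis vectors: `|b⟩ ↦ |σ b⟩`. -/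
noncomputable def permUnitary {ι : Type} (σ : Equiv.Perm ι) :
    StateSpace ι ≃ₗᵢ[ℂ] StateSpace ι where
  toFun ψ := ⟨fun b => ψ (σ.symm b), memlp_comp_equiv σ.symm ψ⟩
  invFun ψ := ⟨fun b => ψ (σ b), memlp_comp_equiv σ ψ⟩
  left_inv ψ := by ext b; simp
  right_inv ψ := by ext b; simp
  map_add' ψ φ := by ext b; rfl
  map_smul' c ψ := by ext b; rfl
  norm_map' ψ := by
    have h2 : 0 < (2 : ℝ≥0∞).toReal := by norm_num
    rw [lp.norm_eq_tsum_rpow h2, lp.norm_eq_tsum_rpow h2]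
    congr 1
    exact Equiv.tsum_eq σ.symm (fun b => ‖ψ b‖ ^ (2 : ℝ≥0∞).toReal)

theorem permUnitary_apply {ι : Type} (σ : Equiv.Perm ι) (ψ : StateSpace ι) (b : ι) :
    permUnitary σ ψ b = ψ (σ.symm b) := rfl

/-- The basis labels `|q, a, z⟩`: a query, an answer bit and the content of the work register. -/
abbrev Register (Q W : Type) : Type := Q × Bool × W

/-- The permutation `(q, a, z) ↦ (q, a ⊕ g q, z)` of the basis labels. -/
def oraclePerm {Q : Type} (W : Type) (g : Q → Bool) : Equiv.Perm (Register Q W) where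
  toFun b := (b.1, xor b.2.1 (g b.1), b.2.2)
  invFun b := (b.1, xor b.2.1 (g b.1), b.2.2)
  left_inv b := by simp
  right_inv b := by simp

/-- The oracle unitary `|q, a, z⟩ ↦ |q, a ⊕ g q, z⟩`. -/
noncomputable def oracleUnitary {Q : Type} (W : Type) (g : Q → Bool) :
    StateSpace (Register Q W) ≃ₗᵢ[ℂ] StateSpace (Register Q W) :=
  permUnitary (oraclePerm W g)

/-- A quantum query algorithm with queries from `Q` and results in `R`: a work register, an
initial state, a number of queries, input-independent unitaries `step 0`, `step 1`, … around the
queries, and the function that turns the outcome of the final measurement in the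
basis `|q, a, z⟩` into a result. -/
structure QuantumQueryAlgorithm (Q R : Type) where
  Work : Type
  init : StateSpace (Register Q Work)
  norm_init : ‖init‖ = 1
  numQueries : ℕ
  step : ℕ → StateSpace (Register Q Work) ≃ₗᵢ[ℂ] StateSpace (Register Q Work)
  output : Register Q Work → R

namespace QuantumQueryAlgorithm

variable {Q R : Type}

/-- The state `step t ∘ O ∘ step (t - 1) ∘ O ∘ ⋯ ∘ O ∘ step 0` applied to `init`, which has
used `t` queries to the oracle `O` given by `g`. -/
noncomputable def state (A : QuantumQueryAlgorithm Q R) (g : Q → Bool) :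
    ℕ → StateSpace (Register Q A.Work)
  | 0 => A.step 0 A.init
  | t + 1 => A.step (t + 1) (oracleUnitary A.Work g (A.state g t))

/-- The probability that `A`, run with the oracle given by `g`, outputs `r`. -/
noncomputable def outputProb (A : QuantumQueryAlgorithm Q R) (g : Q → Bool) (r : R) : ℝ :=
  ∑' b : {b : Register Q A.Work // A.output b = r}, ‖A.state g A.numQueries b.1‖ ^ 2

/-- `A` computes `f x` with error probability at most `ε` on every input `x`, where the input is
given by the oracle `ζ x`. -/
def Computes {S : Type} (A : QuantumQueryAlgorithm Q R) (ζ : S → Q → Bool) (f : S → R)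
    (ε : ℝ) : Prop :=
  ∀ x : S, 1 - ε ≤ A.outputProb (ζ x) (f x)

end QuantumQueryAlgorithm

/-- The `ε`-error quantum query complexity of `f` with the oracles `ζ x`: the least number of
queries of a quantum algorithm that computes `f` with error at most `ε` (and `⊤` if there is
no such algorithm). -/
noncomputable def quantumQueryComplexity {S Q R : Type} (ζ : S → Q → Bool) (f : S → R)
    (ε : ℝ) : ℕ∞ :=
  sInf {t : ℕ∞ | ∃ A : QuantumQueryAlgorithm Q R, A.Computes ζ f ε ∧ t = (A.numQueries : ℕ∞)}

/-- Queries to an anchored substring oracle: a position in `{0, …, N - 1}` and a binary string. -/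
abbrev ASQuery (N : ℕ) : Type := Fin N × List Bool

open Classical in
/-- The answer of the anchored substring oracle `X` to the query `(i, s)`: it is `true` iff the
positions `i, …, i + |s| - 1` all lie within `X` and `x_i ⋯ x_{i + |s| - 1} = s`. -/
noncomputable def asAnswer {N : ℕ} (X : Fin N → Bool) (q : ASQuery N) : Bool :=
  decide (∀ k : Fin q.2.length, ∃ h : (q.1 : ℕ) + (k : ℕ) < N, X ⟨q.1 + k, h⟩ = q.2.get k)

/-- The `ε`-error quantum query complexity of identifying an `N`-bit anchored substring oracle. -/
noncomputable def asIdentificationComplexity (N : ℕ) (ε : ℝ) : ℕ∞ :=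
  quantumQueryComplexity (fun X : Fin N → Bool => asAnswer X) (fun X => X) ε

/-! If oracle answers depended only on one of K classes of queries, each query would multiply the
dimension of the span of the reachable states by at most K + 1. Success probabilities summed over
all inputs are at most that dimension, so T queries would need (K + 1)^T of order 2^N. The AS-oracle
has too many query strings for this directly.

Hashing cures that: for a random h, compare h(s) with the hash of the substring of X instead of
comparing s with it. The classes are then position, length and hash value, polynomially many in N.
On a fixed query the answer changes only by a collision, with probability at most 1/M for M hash
values, so a hybrid argument bounds the mean squared change of the final state by 4T²/M. With M =
64N² and T ≤ N this is negligible, and logarithms give the bound. See `exists_submodule_state_mem`,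
`sum_norm_sq_state_sub_le` and `Computes.card_mul_le`. -/

theorem Summable.tsum_eq_sum_tsum_fiber {ι S : Type*} [Fintype S] {F : ι → ℝ} (hF : Summable F)
    (out : ι → S) : ∑' b, F b = ∑ x, ∑' b : {b // out b = x}, F b.1 := by
  have h : Summable fun p : Σ x, {b // out b = x} => F p.2.1 :=
    (Equiv.sigmaFiberEquiv out).summable_iff.2 hF
  rw [← (Equiv.sigmaFiberEquiv out).tsum_eq F, ← tsum_fintype (L := .unconditional S)]
  exact h.tsum_sigma

/-! ### Measurement probabilities and dimension -/

section StateSpace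

variable {ι : Type}

theorem StateSpace.summable_norm_sq (ψ : StateSpace ι) : Summable fun b => ‖ψ b‖ ^ 2 := by
  have h := (memℓp_gen_iff (p := 2) (by norm_num)).1 (lp.memℓp ψ)
  simpa using h

theorem StateSpace.norm_sq_eq_tsum (ψ : StateSpace ι) : ‖ψ‖ ^ 2 = ∑' b, ‖ψ b‖ ^ 2 := by
  have h := lp.norm_rpow_eq_tsum (p := 2) (by norm_num) ψ
  simpa using h

/-- A unit vector in a subspace has its entries bounded by those of the projection onto it. -/
theorem StateSpace.norm_sq_apply_le_sum {V : Submodule ℂ (StateSpace ι)} {n : ℕ}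
    (e : OrthonormalBasis (Fin n) ℂ V) (ψ : V) (hψ : ‖ψ‖ ≤ 1) (b : ι) :
    ‖(ψ : StateSpace ι) b‖ ^ 2 ≤ ∑ j, ‖(e j : StateSpace ι) b‖ ^ 2 := by
  have h1 : (ψ : StateSpace ι) b = ∑ j, e.repr ψ j * (e j : StateSpace ι) b := by
    have h := congrArg (fun v : V => (v : StateSpace ι) b) (e.sum_repr ψ)
    simp only [Submodule.coe_sum, lp.coeFn_sum, Finset.sum_apply] at h
    rw [← h]
    rfl
  have h2 : ∑ j, ‖e.repr ψ j‖ ^ 2 ≤ 1 := by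
    rw [← EuclideanSpace.norm_sq_eq, e.repr.norm_map]
    exact pow_le_one₀ (norm_nonneg _) hψ
  have h3 : ‖(ψ : StateSpace ι) b‖ ≤ ∑ j, ‖e.repr ψ j‖ * ‖(e j : StateSpace ι) b‖ := by
    rw [h1]
    exact (norm_sum_le _ _).trans_eq (by simp)
  calc ‖(ψ : StateSpace ι) b‖ ^ 2
      ≤ (∑ j, ‖e.repr ψ j‖ * ‖(e j : StateSpace ι) b‖) ^ 2 := by gcongr
    _ ≤ (∑ j, ‖e.repr ψ j‖ ^ 2) * ∑ j, ‖(e j : StateSpace ι) b‖ ^ 2 :=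
        Finset.sum_mul_sq_le_sq_mul_sq _ _ _
    _ ≤ 1 * ∑ j, ‖(e j : StateSpace ι) b‖ ^ 2 := by gcongr
    _ = _ := one_mul _

/-- Unit vectors of a `d`-dimensional subspace, each measured on its own part of a partition of
the basis, have total weight at most `d`. -/
theorem StateSpace.sum_tsum_fiber_le_finrank {S : Type} [Fintype S] (out : ι → S)
    (V : Submodule ℂ (StateSpace ι)) [FiniteDimensional ℂ V] (ψ : S → StateSpace ι)
    (hV : ∀ x, ψ x ∈ V) (hψ : ∀ x, ‖ψ x‖ ≤ 1) :
    ∑ x, ∑' b : {b // out b = x}, ‖ψ x b.1‖ ^ 2 ≤ Module.finrank ℂ V := by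
  set e := stdOrthonormalBasis ℂ V
  set F : ι → ℝ := fun b => ∑ j, ‖(e j : StateSpace ι) b‖ ^ 2 with hF
  have hFs : Summable F := summable_sum fun j _ => StateSpace.summable_norm_sq _
  have hFt : ∑' b, F b = Module.finrank ℂ V := by
    rw [hF, Summable.tsum_finsetSum fun j _ => StateSpace.summable_norm_sq _]
    simp_rw [← StateSpace.norm_sq_eq_tsum]
    have : ∀ j, ‖(e j : StateSpace ι)‖ = 1 := fun j => e.norm_eq_one j
    simp [this]
  rw [← hFt, hFs.tsum_eq_sum_tsum_fiber out]
  refine Finset.sum_le_sum fun x _ => ?_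
  refine Summable.tsum_le_tsum (fun b => ?_)
    ((StateSpace.summable_norm_sq (ψ x)).subtype {b | out b = x})
    (hFs.subtype {b | out b = x})
  exact StateSpace.norm_sq_apply_le_sum e ⟨ψ x, hV x⟩ (hψ x) b.1

/-- The factor 2 is lossy, but it leaves the squared distance, which is what averages well over the
hash functions. -/
theorem StateSpace.tsum_subtype_norm_sq_le (s : ι → Prop) (φ ψ : StateSpace ι) :
    ∑' b : {b // s b}, ‖φ b.1‖ ^ 2 ≤
      2 * (∑' b : {b // s b}, ‖ψ b.1‖ ^ 2) + 2 * ‖φ - ψ‖ ^ 2 := by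
  have hφ := (StateSpace.summable_norm_sq φ).subtype {b | s b}
  have hψ := (StateSpace.summable_norm_sq ψ).subtype {b | s b}
  have hd := (StateSpace.summable_norm_sq (φ - ψ)).subtype {b | s b}
  have hle : ∑' b : {b // s b}, ‖(φ - ψ) b.1‖ ^ 2 ≤ ‖φ - ψ‖ ^ 2 := by
    rw [StateSpace.norm_sq_eq_tsum]
    exact Summable.tsum_subtype_le _ {b | s b} (fun b => by positivity)
      (StateSpace.summable_norm_sq _)
  calc ∑' b : {b // s b}, ‖φ b.1‖ ^ 2
      ≤ ∑' b : {b // s b}, (2 * ‖ψ b.1‖ ^ 2 + 2 * ‖(φ - ψ) b.1‖ ^ 2) := by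
        refine Summable.tsum_le_tsum (fun b => ?_) hφ ((hψ.mul_left 2).add (hd.mul_left 2))
        have h : ‖φ b.1‖ ≤ ‖ψ b.1‖ + ‖(φ - ψ) b.1‖ := by
          simpa using norm_add_le (ψ b.1) ((φ - ψ) b.1)
        nlinarith [norm_nonneg (φ b.1), sq_nonneg (‖ψ b.1‖ - ‖(φ - ψ) b.1‖)]
    _ = 2 * (∑' b : {b // s b}, ‖ψ b.1‖ ^ 2) + 2 * ∑' b : {b // s b}, ‖(φ - ψ) b.1‖ ^ 2 := by
        rw [← tsum_mul_left, ← tsum_mul_left]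
        exact Summable.tsum_add (hψ.mul_left 2) (hd.mul_left 2)
    _ ≤ _ := by gcongr

end StateSpace

/-! ### A single query -/

section Oracle

variable {Q W : Type}

theorem oracleUnitary_apply (g : Q → Bool) (ψ : StateSpace (Register Q W)) (b : Register Q W) :
    oracleUnitary W g ψ b = ψ (b.1, xor b.2.1 (g b.1), b.2.2) := rfl

/-- The oracles differ at a query by flipping the answer bit. The constantly true oracle performs
this flip everywhere, so the bound has total mass controlled by its unitarity. -/
theorem norm_sq_oracleUnitary_sub_apply_le (g g' : Q → Bool) (φ : StateSpace (Register Q W))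
    (b : Register Q W) :
    ‖(oracleUnitary W g φ - oracleUnitary W g' φ) b‖ ^ 2 ≤
      if g' b.1 ≠ g b.1 then
        2 * (‖φ b‖ ^ 2 + ‖oracleUnitary W (fun _ => true) φ b‖ ^ 2) else 0 := by
  obtain ⟨q, a, z⟩ := b
  simp only [lp.coeFn_sub, Pi.sub_apply, oracleUnitary_apply]
  have key : ∀ u v : ℂ, ‖u - v‖ ^ 2 ≤ 2 * (‖u‖ ^ 2 + ‖v‖ ^ 2) := fun u v => by
    nlinarith [norm_sub_le u v, norm_nonneg (u - v), sq_nonneg (‖u‖ - ‖v‖)]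
  cases h : g q <;> cases h' : g' q <;> simp
  · simpa using key (φ (q, a, z)) (φ (q, !a, z))
  · simpa [add_comm] using key (φ (q, !a, z)) (φ (q, a, z))

/-- If the oracles `g' h` disagree with `g` on each query for at most `δ` of the `h`, then
the total squared error made by one query is at most `4 δ`. -/
theorem sum_norm_sq_oracleUnitary_sub_le {H : Type} [Fintype H] (g : Q → Bool)
    (g' : H → Q → Bool) (δ : ℝ)
    (hδ : ∀ q, ((Finset.univ.filter fun h => g' h q ≠ g q).card : ℝ) ≤ δ)
    (φ : StateSpace (Register Q W)) (hφ : ‖φ‖ = 1) :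
    ∑ h, ‖oracleUnitary W g φ - oracleUnitary W (g' h) φ‖ ^ 2 ≤ 4 * δ := by
  set F : Register Q W → ℝ :=
    fun b => ‖φ b‖ ^ 2 + ‖oracleUnitary W (fun _ => true) φ b‖ ^ 2 with hF
  have hFs : Summable F :=
    (StateSpace.summable_norm_sq φ).add (StateSpace.summable_norm_sq _)
  have hFt : ∑' b, F b = 2 := by
    rw [hF, (StateSpace.summable_norm_sq φ).tsum_add (StateSpace.summable_norm_sq _),
      ← StateSpace.norm_sq_eq_tsum, ← StateSpace.norm_sq_eq_tsum,
      (oracleUnitary W fun _ => true).norm_map, hφ]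
    norm_num
  simp_rw [StateSpace.norm_sq_eq_tsum]
  rw [← Summable.tsum_finsetSum fun h _ => StateSpace.summable_norm_sq _]
  calc ∑' b, ∑ h, ‖(oracleUnitary W g φ - oracleUnitary W (g' h) φ) b‖ ^ 2
      ≤ ∑' b, (2 * δ) * F b := by
        refine Summable.tsum_le_tsum (fun b => ?_)
          (summable_sum fun h _ => StateSpace.summable_norm_sq _) (hFs.mul_left _)
        refine (Finset.sum_le_sum fun h _ =>
          norm_sq_oracleUnitary_sub_apply_le g (g' h) φ b).trans ?_
        rw [← Finset.sum_filter, Finset.sum_const, nsmul_eq_mul]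
        have h0 : 0 ≤ F b := by positivity
        nlinarith [mul_le_mul_of_nonneg_right (hδ b.1) h0]
    _ = 4 * δ := by rw [tsum_mul_left, hFt]; ring

open Classical in
/-- An oracle that depends on the class `κ q` of a query only is a combination of the oracles
that recognise a single class. -/
theorem oracleUnitary_eq_add_sum {C : Type} [Fintype C] (κ : Q → C) (G : C → Bool)
    (ψ : StateSpace (Register Q W)) :
    oracleUnitary W (fun q => G (κ q)) ψ =
      ψ + ∑ c with G c = true, (oracleUnitary W (fun q => decide (κ q = c)) ψ - ψ) := by
  ext ⟨q, a, z⟩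
  simp only [lp.coeFn_add, lp.coeFn_sum, Pi.add_apply, Finset.sum_apply, lp.coeFn_sub,
    Pi.sub_apply, oracleUnitary_apply]
  have h : ∀ c, c ≠ κ q → ψ (q, xor a (decide (κ q = c)), z) - ψ (q, a, z) = 0 := by
    intro c hc
    simp [hc.symm]
  rw [Finset.sum_filter, Finset.sum_eq_single (κ q)]
  · cases hG : G (κ q) <;> simp
  · intro c _ hc
    simp [h c hc]
  · simp

end Oracle

theorem Submodule.finrank_finset_sup_le_sum {K E ι : Type*} [DivisionRing K] [AddCommGroup E]
    [Module K E] (s : Finset ι) (V : ι → Submodule K E) [∀ i, FiniteDimensional K (V i)] :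
    Module.finrank K ↥(s.sup V) ≤ ∑ i ∈ s, Module.finrank K (V i) := by
  classical
  induction s using Finset.induction_on with
  | empty => simp
  | insert i s hi ih =>
    rw [Finset.sup_insert, Finset.sum_insert hi]
    exact (Submodule.finrank_add_le_finrank_add_finrank _ _).trans (by gcongr)

/-! ### Hybrid argument and dimension count -/

namespace QuantumQueryAlgorithm

variable {Q R : Type}

theorem norm_state (A : QuantumQueryAlgorithm Q R) (g : Q → Bool) (t : ℕ) :
    ‖A.state g t‖ = 1 := by
  induction t with
  | zero => rw [state, LinearIsometryEquiv.norm_map, A.norm_init]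
  | succ t ih => rw [state, LinearIsometryEquiv.norm_map, LinearIsometryEquiv.norm_map, ih]

/-- Hybrid argument: every per-query error is measured on the run with `g`, and later unitaries do
not amplify it. -/
theorem norm_state_sub_state_le (A : QuantumQueryAlgorithm Q R) (g g' : Q → Bool) (t : ℕ) :
    ‖A.state g t - A.state g' t‖ ≤ ∑ k ∈ Finset.range t,
      ‖oracleUnitary A.Work g (A.state g k) - oracleUnitary A.Work g' (A.state g k)‖ := by
  induction t with
  | zero => simp [state]
  | succ t ih =>
    rw [Finset.sum_range_succ, state, state, ← map_sub, LinearIsometryEquiv.norm_map]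
    refine (norm_sub_le_norm_sub_add_norm_sub _ (oracleUnitary A.Work g' (A.state g t)) _).trans ?_
    rw [← map_sub (oracleUnitary A.Work g'), LinearIsometryEquiv.norm_map, add_comm]
    gcongr

/-- Replacing the oracle `g` by one of the oracles `g' h`, which disagree with `g` on each query
for at most `δ` of the `h`, changes the state after `t` queries little for most `h`. -/
theorem sum_norm_sq_state_sub_le (A : QuantumQueryAlgorithm Q R) {H : Type} [Fintype H]
    (g : Q → Bool) (g' : H → Q → Bool) (δ : ℝ)
    (hδ : ∀ q, ((Finset.univ.filter fun h => g' h q ≠ g q).card : ℝ) ≤ δ) (t : ℕ) :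
    ∑ h, ‖A.state g t - A.state (g' h) t‖ ^ 2 ≤ 4 * (t : ℝ) ^ 2 * δ := by
  calc ∑ h, ‖A.state g t - A.state (g' h) t‖ ^ 2
      ≤ ∑ h, (t : ℝ) * ∑ k ∈ Finset.range t,
          ‖oracleUnitary A.Work g (A.state g k) - oracleUnitary A.Work (g' h) (A.state g k)‖ ^ 2 := by
        refine Finset.sum_le_sum fun h _ => ?_
        refine (pow_le_pow_left₀ (norm_nonneg _) (A.norm_state_sub_state_le g (g' h) t) 2).trans ?_
        simpa using sq_sum_le_card_mul_sum_sq (s := Finset.range t) (f := fun k =>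
          ‖oracleUnitary A.Work g (A.state g k) - oracleUnitary A.Work (g' h) (A.state g k)‖)
    _ = (t : ℝ) * ∑ k ∈ Finset.range t, ∑ h,
          ‖oracleUnitary A.Work g (A.state g k) - oracleUnitary A.Work (g' h) (A.state g k)‖ ^ 2 := by
        rw [← Finset.mul_sum, Finset.sum_comm]
    _ ≤ (t : ℝ) * ∑ k ∈ Finset.range t, 4 * δ := by
        gcongr with k _
        exact sum_norm_sq_oracleUnitary_sub_le g g' δ hδ _ (A.norm_state g k)
    _ = 4 * (t : ℝ) ^ 2 * δ := by simp; ring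

/-- With oracles that depend on one of `card C` classes of the query only, the states after
`t` queries lie in a common subspace of dimension at most `(card C + 1) ^ t`. -/
theorem exists_submodule_state_mem (A : QuantumQueryAlgorithm Q R) {C : Type} [Fintype C]
    (κ : Q → C) (t : ℕ) :
    ∃ V : Submodule ℂ (StateSpace (Register Q A.Work)), FiniteDimensional ℂ V ∧
      Module.finrank ℂ V ≤ (Fintype.card C + 1) ^ t ∧
      ∀ G : C → Bool, A.state (fun q => G (κ q)) t ∈ V := by
  classical
  induction t with
  | zero =>
    refine ⟨ℂ ∙ A.step 0 A.init, inferInstance, ?_, fun G => ?_⟩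
    · simpa using finrank_span_le_card (R := ℂ) ({A.step 0 A.init} : Set _)
    · exact Submodule.mem_span_singleton_self _
  | succ t ih =>
    obtain ⟨V, hfin, hdim, hmem⟩ := ih
    let step : StateSpace (Register Q A.Work) →ₗ[ℂ] StateSpace (Register Q A.Work) :=
      (A.step (t + 1)).toLinearEquiv.toLinearMap
    -- `none` is the identity, which accounts for the `+ 1` in the growth factor.
    let L : Option C → StateSpace (Register Q A.Work) →ₗ[ℂ] StateSpace (Register Q A.Work) :=
      fun o => o.elim LinearMap.id fun c =>
        (oracleUnitary A.Work fun q => decide (κ q = c)).toLinearEquiv.toLinearMap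
    let U : Submodule ℂ (StateSpace (Register Q A.Work)) := Finset.univ.sup fun o => V.map (L o)
    have hU : FiniteDimensional ℂ U := inferInstance
    refine ⟨U.map step, inferInstance, ?_, fun G => ?_⟩
    · calc _ ≤ Module.finrank ℂ U := Submodule.finrank_map_le _ _
        _ ≤ ∑ o, Module.finrank ℂ (V.map (L o)) :=
            Submodule.finrank_finset_sup_le_sum _ _
        _ ≤ ∑ _o : Option C, (Fintype.card C + 1) ^ t :=
            Finset.sum_le_sum fun o _ => (Submodule.finrank_map_le _ _).trans hdim
        _ = _ := by simp [pow_succ, mul_comm]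
    · refine Submodule.mem_map_of_mem (f := step) ?_
      have h0 : ∀ ψ ∈ V, ∀ o, L o ψ ∈ U := fun ψ hψ o =>
        Finset.le_sup (f := fun o => V.map (L o)) (Finset.mem_univ o)
          (Submodule.mem_map_of_mem hψ)
      rw [oracleUnitary_eq_add_sum]
      exact U.add_mem (h0 _ (hmem G) none) (U.sum_mem fun c _ =>
        U.sub_mem (h0 _ (hmem G) (some c)) (h0 _ (hmem G) none))

/-- An algorithm that identifies `x` from the oracle `g x` with error `ε` makes many queries
if `g x` is approximated by random oracles that depend on few classes of queries only. -/
theorem Computes.card_mul_le {S : Type} [Fintype S] (A : QuantumQueryAlgorithm Q S)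
    {g : S → Q → Bool} {ε : ℝ} (hA : A.Computes g (fun x => x) ε) {H C : Type} [Fintype H]
    [Nonempty H] [Fintype C] (κ : H → Q → C) (G : H → S → C → Bool) (δ : ℝ)
    (hδ : ∀ x q, ((Finset.univ.filter fun h => G h x (κ h q) ≠ g x q).card : ℝ) ≤
      δ * Fintype.card H) :
    (1 - ε) * Fintype.card S ≤ 2 * ((Fintype.card C : ℝ) + 1) ^ A.numQueries +
      8 * (A.numQueries : ℝ) ^ 2 * δ * Fintype.card S := by
  set T := A.numQueries with hT
  have hH : (0 : ℝ) < Fintype.card H := by exact_mod_cast Fintype.card_pos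
  have h1 : ∀ h, ∑ x, A.outputProb (fun q => G h x (κ h q)) x ≤
      ((Fintype.card C : ℝ) + 1) ^ T := by
    intro h
    obtain ⟨V, hfin, hdim, hmem⟩ := A.exists_submodule_state_mem (κ h) T
    refine (StateSpace.sum_tsum_fiber_le_finrank A.output V
      (fun x => A.state (fun q => G h x (κ h q)) T) (fun x => hmem _)
      (fun x => (A.norm_state _ _).le)).trans ?_
    exact_mod_cast hdim
  have h2 : ∀ x, (1 - ε) * Fintype.card H ≤
      2 * (∑ h, A.outputProb (fun q => G h x (κ h q)) x) +
        2 * (4 * (T : ℝ) ^ 2 * (δ * Fintype.card H)) := by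
    intro x
    have h3 : ∀ h, 1 - ε ≤ 2 * A.outputProb (fun q => G h x (κ h q)) x +
        2 * ‖A.state (g x) T - A.state (fun q => G h x (κ h q)) T‖ ^ 2 := fun h =>
      (hA x).trans (StateSpace.tsum_subtype_norm_sq_le (fun b => A.output b = x) _ _)
    have h4 := Finset.sum_le_sum fun h (_ : h ∈ Finset.univ) => h3 h
    rw [Finset.sum_add_distrib, ← Finset.mul_sum, ← Finset.mul_sum, Finset.sum_const,
      nsmul_eq_mul, Finset.card_univ] at h4
    have h5 := A.sum_norm_sq_state_sub_le (g x) (fun h q => G h x (κ h q)) _ (hδ x) T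
    linarith
  -- The dimension bound holds for each fixed `h` and the hybrid bound for each fixed `x`, so the
  -- double sum is exchanged.
  have h6 := Finset.sum_le_sum fun x (_ : x ∈ Finset.univ) => h2 x
  rw [Finset.sum_add_distrib, ← Finset.mul_sum _ _ (2 : ℝ), Finset.sum_comm, Finset.sum_const,
    Finset.sum_const, nsmul_eq_mul, nsmul_eq_mul, Finset.card_univ] at h6
  have h7 := Finset.sum_le_sum fun h (_ : h ∈ Finset.univ) => h1 h
  rw [Finset.sum_const, nsmul_eq_mul, Finset.card_univ] at h7
  refine le_of_mul_le_mul_right ?_ hH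
  linarith

end QuantumQueryAlgorithm

/-! ### Hashing the query strings -/

section Hash

/-- A random function to `M` values takes the same value at two points with
probability `1 / M`. -/
theorem card_filter_apply_eq_apply_mul_le {L : Type} [Fintype L] [DecidableEq L] (M : ℕ)
    {a b : L} (hab : a ≠ b) :
    (Finset.univ.filter fun h : L → Fin M => h a = h b).card * M ≤ Fintype.card (L → Fin M) := by
  -- Overwriting the value at `a` loses nothing when `h a = h b`: it can be recovered from `b`.
  have h : Function.Injective
      fun p : {h : L → Fin M // h a = h b} × Fin M => Function.update p.1.1 a p.2 := by
    rintro ⟨⟨f, hf⟩, i⟩ ⟨⟨f', hf'⟩, i'⟩ h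
    have hi : i = i' := by simpa using congrFun h a
    have hne : ∀ l, l ≠ a → f l = f' l := fun l hl => by
      simpa [Function.update_of_ne hl] using congrFun h l
    have hff : f = f' := by
      ext1 l
      by_cases hl : l = a
      · rw [hl, hf, hf', hne b hab.symm]
      · exact hne l hl
    subst hi hff
    rfl
  simpa [Fintype.card_subtype] using Fintype.card_le_of_injective _ h

/-- The substring of `X` of length at most `k` that starts at position `i`. -/
def window {N : ℕ} (X : Fin N → Bool) (i k : ℕ) : List Bool :=
  ((List.ofFn X).drop i).take k

theorem length_window_le {N : ℕ} (X : Fin N → Bool) (i k : ℕ) : (window X i k).length ≤ N := by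
  simp [window]

theorem asAnswer_eq_decide_window {N : ℕ} (X : Fin N → Bool) (i : Fin N) (s : List Bool) :
    asAnswer X (i, s) = decide (window X i s.length = s) := by
  rw [asAnswer, decide_eq_decide]
  constructor
  · intro h
    refine List.ext_getElem ?_ fun k h1 h2 => ?_
    · simp only [window, List.length_take, List.length_drop, List.length_ofFn]
      rcases Nat.eq_zero_or_pos s.length with h0 | h0
      · omega
      -- The last character of `s` shows that the window is not truncated by the end of `X`.
      · obtain ⟨h1, -⟩ := h ⟨s.length - 1, by simpa using h0⟩
        simp only at h1
        omega
    · obtain ⟨h3, h4⟩ := h ⟨k, h2⟩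
      simpa [window] using h4
  · intro h k
    have hk := k.2
    have hlen := congrArg List.length h
    simp only [window, List.length_take, List.length_drop, List.length_ofFn] at hlen
    simp only at hk
    refine ⟨show (i : ℕ) + k < N by omega, ?_⟩
    have h2 : (window X i s.length)[(k : ℕ)]? = s[(k : ℕ)]? := by rw [h]
    rw [List.getElem?_eq_getElem hk] at h2
    obtain ⟨h3, h4⟩ := List.getElem?_eq_some_iff.1 h2
    simpa [window] using h4

/-- Binary strings of length at most `N`. -/
abbrev ShortList (N : ℕ) : Type := {l : List Bool // l.length ≤ N}

noncomputable instance (N : ℕ) : Fintype (ShortList N) :=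
  (List.finite_length_le Bool N).fintype

/-- The position, the length and the hash value of a query; `none` if the string is too long
to match. -/
def hashClass {N M : ℕ} (h : ShortList N → Fin M) (q : ASQuery N) :
    Option (Fin N × Fin (N + 1) × Fin M) :=
  if hq : q.2.length ≤ N then some (q.1, ⟨q.2.length, by omega⟩, h ⟨q.2, hq⟩) else none

/-- Whether the hash value of the substring of `X` at a given position and of given length is
the given one. -/
def hashAnswer {N M : ℕ} (h : ShortList N → Fin M) (X : Fin N → Bool) :
    Option (Fin N × Fin (N + 1) × Fin M) → Bool
  | none => false
  | some c => decide (h ⟨window X c.1 c.2.1, length_window_le _ _ _⟩ = c.2.2)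

/-- The error is one-sided: a true match always passes the hash test, and overlong strings are
always rejected. Only a collision of two distinct strings misleads. -/
theorem card_filter_hashAnswer_ne_le {N M : ℕ} (hM : 0 < M) (X : Fin N → Bool) (q : ASQuery N) :
    ((Finset.univ.filter fun h : ShortList N → Fin M =>
      hashAnswer h X (hashClass h q) ≠ asAnswer X q).card : ℝ) ≤
      (1 / M : ℝ) * Fintype.card (ShortList N → Fin M) := by
  obtain ⟨i, s⟩ := q
  have hM' : (0 : ℝ) < M := by exact_mod_cast hM
  rw [asAnswer_eq_decide_window]
  have hempty : ∀ p : (ShortList N → Fin M) → Prop, ∀ [DecidablePred p], (∀ h, ¬ p h) →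
      ((Finset.univ.filter p).card : ℝ) ≤ (1 / M : ℝ) * Fintype.card (ShortList N → Fin M) := by
    intro p _ hp
    rw [Finset.filter_false_of_mem fun h _ => hp h]
    simp only [Finset.card_empty, Nat.cast_zero]
    positivity
  by_cases hs : s.length ≤ N
  · by_cases hw : window X i s.length = s
    · refine hempty _ fun h => ?_
      simp [hashClass, hashAnswer, hs, hw]
    · have hne : (⟨window X i s.length, length_window_le _ _ _⟩ : ShortList N) ≠ ⟨s, hs⟩ :=
        fun h => hw (congrArg Subtype.val h)
      have h1 := card_filter_apply_eq_apply_mul_le M hne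
      rw [one_div, ← div_eq_inv_mul, le_div_iff₀ hM']
      have h2 : (Finset.univ.filter fun h : ShortList N → Fin M =>
          hashAnswer h X (hashClass h (i, s)) ≠ decide (window X i s.length = s)) =
          Finset.univ.filter fun h : ShortList N → Fin M =>
            h ⟨window X i s.length, length_window_le _ _ _⟩ = h ⟨s, hs⟩ := by
        ext h
        simp [hashClass, hashAnswer, hs, hw]
      rw [h2]
      exact_mod_cast h1
  · refine hempty _ fun h => ?_
    have hw : window X i s.length ≠ s := fun h => hs (h ▸ length_window_le _ _ _)
    simp [hashClass, hashAnswer, hs, hw]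

end Hash

/-! ### The lower bound -/

theorem two_pow_le_of_computes {N : ℕ} (hN : 0 < N) {ε : ℝ} (hε : ε < 1 / 2)
    (A : QuantumQueryAlgorithm (ASQuery N) (Fin N → Bool))
    (hA : A.Computes (fun X : Fin N → Bool => asAnswer X) (fun X => X) ε)
    (hT : A.numQueries ≤ N) :
    (2 : ℝ) ^ N ≤ 8 * ((N : ℝ) * ((N + 1) * (64 * N ^ 2)) + 2) ^ A.numQueries := by
  have hM : 0 < 64 * N ^ 2 := by positivity
  have : Nonempty (ShortList N → Fin (64 * N ^ 2)) := ⟨fun _ => ⟨0, hM⟩⟩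
  have h := QuantumQueryAlgorithm.Computes.card_mul_le A hA
    (H := ShortList N → Fin (64 * N ^ 2)) hashClass hashAnswer _
    (card_filter_hashAnswer_ne_le hM)
  have hN' : (0 : ℝ) < N := by exact_mod_cast hN
  have hT' : (A.numQueries : ℝ) ≤ N := by exact_mod_cast hT
  -- The choice of 64N² hash values keeps the loss at 1/8, below 1 - ε > 1/2.
  have h8 : 8 * (A.numQueries : ℝ) ^ 2 * (1 / (64 * N ^ 2 : ℕ) : ℝ) ≤ 1 / 8 := by
    push_cast
    rw [mul_one_div, div_le_div_iff₀ (by positivity) (by norm_num)]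
    nlinarith [pow_le_pow_left₀ (Nat.cast_nonneg A.numQueries) hT' 2]
  have hS : (Fintype.card (Fin N → Bool) : ℝ) = 2 ^ N := by simp
  have hC : (Fintype.card (Option (Fin N × Fin (N + 1) × Fin (64 * N ^ 2))) : ℝ) + 1 =
      (N : ℝ) * ((N + 1) * (64 * N ^ 2)) + 2 := by
    simp only [Fintype.card_option, Fintype.card_prod, Fintype.card_fin]
    push_cast
    ring
  rw [hS, hC] at h
  have hp : (0 : ℝ) < 2 ^ N := by positivity
  have h9 := mul_le_mul_of_nonneg_right h8 hp.le
  have h10 := mul_le_mul_of_nonneg_right (show (1 / 2 : ℝ) ≤ 1 - ε by linarith) hp.le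
  linarith

theorem numQueries_ge_of_computes {N : ℕ} (hN : 6 ≤ N) {ε : ℝ} (hε : ε < 1 / 2)
    (A : QuantumQueryAlgorithm (ASQuery N) (Fin N → Bool))
    (hA : A.Computes (fun X : Fin N → Bool => asAnswer X) (fun X => X) ε) :
    Real.log 2 / 24 * ((N : ℝ) / Real.log N) ≤ A.numQueries := by
  have hN' : (6 : ℝ) ≤ N := by exact_mod_cast hN
  have hl2 : 0 < Real.log 2 := Real.log_pos (by norm_num)
  have hl : Real.log 2 ≤ Real.log N := Real.log_le_log (by norm_num) (by linarith)
  have hlN : 0 < Real.log N := hl2.trans_le hl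
  rw [mul_div_assoc', div_le_iff₀ hlN]
  rcases le_or_gt A.numQueries N with hT | hT
  · have h := two_pow_le_of_computes (by omega) hε A hA hT
    have hK : (N : ℝ) * ((N + 1) * (64 * N ^ 2)) + 2 ≤ (N : ℝ) ^ 12 := by
      have h6 : (6 : ℝ) ^ 7 ≤ (N : ℝ) ^ 7 := by gcongr
      have h5 : (N : ℝ) * ((N + 1) * (64 * N ^ 2)) + 2 ≤ 6 ^ 7 * (N : ℝ) ^ 5 := by
        have h3 : (1 : ℝ) ≤ (N : ℝ) ^ 3 := one_le_pow₀ (by linarith)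
        have h4 : (N : ℝ) ^ 3 ≤ (N : ℝ) ^ 5 := pow_le_pow_right₀ (by linarith) (by norm_num)
        have h4' : (N : ℝ) ^ 4 ≤ (N : ℝ) ^ 5 := pow_le_pow_right₀ (by linarith) (by norm_num)
        nlinarith
      calc _ ≤ 6 ^ 7 * (N : ℝ) ^ 5 := h5
        _ ≤ (N : ℝ) ^ 7 * (N : ℝ) ^ 5 := by gcongr
        _ = _ := by ring
    have h1 : (2 : ℝ) ^ N ≤ 2 ^ 3 * ((N : ℝ) ^ 12) ^ A.numQueries := by
      refine h.trans ?_
      norm_num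
      gcongr
    have h2 := Real.log_le_log (by positivity) h1
    rw [Real.log_mul (by positivity) (by positivity), Real.log_pow, Real.log_pow, Real.log_pow,
      Real.log_pow] at h2
    push_cast at h2
    -- From N log 2 ≤ 3 log 2 + 12 T log N: as N ≥ 6, the term 3 log 2 is at most half the left
    -- side, whence the constant 24.
    nlinarith
  · have hT' : (N : ℝ) ≤ A.numQueries := by exact_mod_cast hT.le
    nlinarith

theorem mainTheorem4 (ε : ℝ) (hε0 : 0 ≤ ε) (hε : ε < 1 / 2) :
    ∃ c : ℝ, 0 < c ∧ ∃ N₀ : ℕ, ∀ N : ℕ, N₀ ≤ N →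
      ENNReal.ofReal (c * ((N : ℝ) / Real.log N)) ≤
        ((asIdentificationComplexity N ε : ℕ∞) : ℝ≥0∞) := by
  refine ⟨Real.log 2 / 24, div_pos (Real.log_pos (by norm_num)) (by norm_num), 6,
    fun N hN => ?_⟩
  rw [asIdentificationComplexity, quantumQueryComplexity]
  rcases Set.eq_empty_or_nonempty {t : ℕ∞ | ∃ A : QuantumQueryAlgorithm (ASQuery N) (Fin N → Bool),
    A.Computes (fun X : Fin N → Bool => asAnswer X) (fun X => X) ε ∧
      t = (A.numQueries : ℕ∞)} with h | h
  · rw [h, sInf_empty]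
    -- Without any algorithm the complexity is `⊤`.
    simp
  · obtain ⟨A, hA, ht⟩ := csInf_mem h
    rw [ht, ENat.toENNReal_coe]
    refine ENNReal.ofReal_le_of_le_toReal ?_
    simpa using numQueries_ge_of_computes hN hε A hA
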